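/- A polytope in $\mathbb{R}^n$ is the convex hull of a finite set, and a polyhedron in $\mathbb{R}^n$ is a finite (possibly empty) union of polytopes. Let $n\in\mathbb{N}$ and let $P\subseteq\mathbb{R}^n$ be a polyhedron, equipped with the subspace topology. Let $\mathrm{Sub}_c(P)$ be the collection of all polyhedra in $\mathbb{R}^n$ that are contained in $P$, and let $\mathrm{Sub}_o(P)=\{O\subseteq P \mid P\setminus O\in \mathrm{Sub}_c(P)\}$. Then $\mathrm{Sub}_o(P)$ is a Heyting subalgebra of the Heyting algebra of open subsets of $P$ (that is, its members are open in $P$, and it contains $\emptyset$ and $P$ and is closed under $\cup$, $\cap$ and the Heyting implication $U\to V=\mathrm{int}_P((P\setminus U)\cup V)$), and the Heyting algebra $\mathrm{Sub}_o(P)$ is locally finite: each of its finitely generated Heyting subalgebras is finite. Dually, $\mathrm{Sub}_c(P)$ is a co-Heyting subalgebra of the co-Heyting algebra of closed subsets of $P$ (that is, its members are closed in $P$, and it contains $\emptyset$ and $P$ and is closed under $\cup$, $\cap$ and the co-Heyting implication $C\leftarrow D=\mathrm{cl}(C\setminus D)$), and the co-Heyting algebra $\mathrm{Sub}_c(P)$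 is locally finite: each of its finitely generated co-Heyting subalgebras is finite. -/

import Mathlib

open TopologicalSpace

/-! ### Subalgebras and local finiteness of Heyting algebras -/

/-- A Heyting subalgebra: a subset containing `⊥` and `⊤` and closed under `⊔`, `⊓` and `⇨`
(hence under the negation `aᶜ = a ⇨ ⊥`). -/
structure HeytingSubalgebra (H : Type*) [HeytingAlgebra H] where
  carrier : Set H
  bot_mem' : ⊥ ∈ carrier
  top_mem' : ⊤ ∈ carrier
  sup_mem' : ∀ {a b : H}, a ∈ carrier → b ∈ carrier → a ⊔ b ∈ carrier
  inf_mem' : ∀ {a b : H}, a ∈ carrier → b ∈ carrier → a ⊓ b ∈ carrier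
  himp_mem' : ∀ {a b : H}, a ∈ carrier → b ∈ carrier → a ⇨ b ∈ carrier

namespace HeytingSubalgebra

variable {H : Type*} [HeytingAlgebra H]

instance instSetLike : SetLike (HeytingSubalgebra H) H where
  coe A := A.carrier
  coe_injective A B h := by cases A; cases B; congr

/-- The Heyting algebra structure that a Heyting subalgebra inherits. -/
instance instHeytingAlgebra (A : HeytingSubalgebra H) : HeytingAlgebra A :=
  letI : Max A := ⟨fun a b => ⟨a ⊔ b, A.sup_mem' a.2 b.2⟩⟩
  letI : Min A := ⟨fun a b => ⟨a ⊓ b, A.inf_mem' a.2 b.2⟩⟩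
  letI : Top A := ⟨⟨⊤, A.top_mem'⟩⟩
  letI : Bot A := ⟨⟨⊥, A.bot_mem'⟩⟩
  letI : HImp A := ⟨fun a b => ⟨(a : H) ⇨ b, A.himp_mem' a.2 b.2⟩⟩
  letI : Compl A := ⟨fun a => ⟨(a : H)ᶜ, by
    rw [← himp_bot]; exact A.himp_mem' a.2 A.bot_mem'⟩⟩
  Function.Injective.heytingAlgebra (fun a : A => (a : H)) Subtype.val_injective
    Iff.rfl Iff.rfl (fun _ _ => rfl) (fun _ _ => rfl) rfl rfl (fun _ => rfl) (fun _ _ => rfl)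

/-- The Heyting subalgebra generated by `S`: the intersection of all Heyting subalgebras
that contain `S`. -/
def closure (S : Set H) : HeytingSubalgebra H where
  carrier := {a | ∀ B : HeytingSubalgebra H, S ⊆ B.carrier → a ∈ B.carrier}
  bot_mem' := fun B _ => B.bot_mem'
  top_mem' := fun B _ => B.top_mem'
  sup_mem' := fun ha hb B hB => B.sup_mem' (ha B hB) (hb B hB)
  inf_mem' := fun ha hb B hB => B.inf_mem' (ha B hB) (hb B hB)
  himp_mem' := fun ha hb B hB => B.himp_mem' (ha B hB) (hb B hB)

/-- A Heyting subalgebra is finitely generated if some finite set generates it. -/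
def IsFinitelyGenerated (A : HeytingSubalgebra H) : Prop :=
  ∃ S : Set H, S.Finite ∧ closure S = A

end HeytingSubalgebra

/-- A Heyting algebra is locally finite if all its finitely generated subalgebras are finite. -/
def IsLocallyFiniteHeyting (H : Type*) [HeytingAlgebra H] : Prop :=
  ∀ A : HeytingSubalgebra H, A.IsFinitelyGenerated → (A : Set H).Finite

/-! ### Subalgebras and local finiteness of co-Heyting algebras -/

/-- A co-Heyting subalgebra: a subset containing `⊥` and `⊤` and closed under `⊔`, `⊓` and the
co-Heyting implication `a \ b` (hence under the co-Heyting negation `￢a = ⊤ \ a`). -/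
structure CoheytingSubalgebra (H : Type*) [CoheytingAlgebra H] where
  carrier : Set H
  bot_mem' : ⊥ ∈ carrier
  top_mem' : ⊤ ∈ carrier
  sup_mem' : ∀ {a b : H}, a ∈ carrier → b ∈ carrier → a ⊔ b ∈ carrier
  inf_mem' : ∀ {a b : H}, a ∈ carrier → b ∈ carrier → a ⊓ b ∈ carrier
  sdiff_mem' : ∀ {a b : H}, a ∈ carrier → b ∈ carrier → a \ b ∈ carrier

namespace CoheytingSubalgebra

variable {H : Type*} [CoheytingAlgebra H]

instance instSetLike : SetLike (CoheytingSubalgebra H) H where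
  coe A := A.carrier
  coe_injective A B h := by cases A; cases B; congr

/-- The co-Heyting algebra structure that a co-Heyting subalgebra inherits. -/
instance instCoheytingAlgebra (A : CoheytingSubalgebra H) : CoheytingAlgebra A :=
  letI : Max A := ⟨fun a b => ⟨a ⊔ b, A.sup_mem' a.2 b.2⟩⟩
  letI : Min A := ⟨fun a b => ⟨a ⊓ b, A.inf_mem' a.2 b.2⟩⟩
  letI : Top A := ⟨⟨⊤, A.top_mem'⟩⟩
  letI : Bot A := ⟨⟨⊥, A.bot_mem'⟩⟩
  letI : SDiff A := ⟨fun a b => ⟨(a : H) \ b, A.sdiff_mem' a.2 b.2⟩⟩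
  letI : HNot A := ⟨fun a => ⟨￢(a : H), by
    rw [← top_sdiff']; exact A.sdiff_mem' A.top_mem' a.2⟩⟩
  Function.Injective.coheytingAlgebra (fun a : A => (a : H)) Subtype.val_injective
    Iff.rfl Iff.rfl (fun _ _ => rfl) (fun _ _ => rfl) rfl rfl (fun _ => rfl) (fun _ _ => rfl)

/-- The co-Heyting subalgebra generated by `S`: the intersection of all co-Heyting subalgebras
that contain `S`. -/
def closure (S : Set H) : CoheytingSubalgebra H where
  carrier := {a | ∀ B : CoheytingSubalgebra H, S ⊆ B.carrier → a ∈ B.carrier}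
  bot_mem' := fun B _ => B.bot_mem'
  top_mem' := fun B _ => B.top_mem'
  sup_mem' := fun ha hb B hB => B.sup_mem' (ha B hB) (hb B hB)
  inf_mem' := fun ha hb B hB => B.inf_mem' (ha B hB) (hb B hB)
  sdiff_mem' := fun ha hb B hB => B.sdiff_mem' (ha B hB) (hb B hB)

/-- A co-Heyting subalgebra is finitely generated if some finite set generates it. -/
def IsFinitelyGenerated (A : CoheytingSubalgebra H) : Prop :=
  ∃ S : Set H, S.Finite ∧ closure S = A

end CoheytingSubalgebra

/-- A co-Heyting algebra is locally finite if all its finitely generated subalgebras are finite. -/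
def IsLocallyFiniteCoheyting (H : Type*) [CoheytingAlgebra H] : Prop :=
  ∀ A : CoheytingSubalgebra H, A.IsFinitelyGenerated → (A : Set H).Finite

/-! ### Polyhedra -/

/-- A polytope in `ℝⁿ` is the convex hull of a finite set. -/
def IsPolytope {n : ℕ} (S : Set (EuclideanSpace ℝ (Fin n))) : Prop :=
  ∃ V : Set (EuclideanSpace ℝ (Fin n)), V.Finite ∧ S = convexHull ℝ V

/-- A (compact) polyhedron in `ℝⁿ` is a finite, possibly empty, union of polytopes. -/
def IsPolyhedron {n : ℕ} (P : Set (EuclideanSpace ℝ (Fin n))) : Prop :=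
  ∃ F : Set (Set (EuclideanSpace ℝ (Fin n))), F.Finite ∧ (∀ T ∈ F, IsPolytope T) ∧ P = ⋃₀ F

/-- The subpolyhedra of `P`: the polyhedra in `ℝⁿ` that are contained in `P`. -/
def subpolyhedra {n : ℕ} (P : Set (EuclideanSpace ℝ (Fin n))) :
    Set (Set (EuclideanSpace ℝ (Fin n))) :=
  {Q | Q ⊆ P ∧ IsPolyhedron Q}

/-- The open subpolyhedra of `P`: the subsets of `P` whose complement in `P` is a subpolyhedron. -/
def openSubpolyhedra {n : ℕ} (P : Set (EuclideanSpace ℝ (Fin n))) :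
    Set (Set (EuclideanSpace ℝ (Fin n))) :=
  {O | O ⊆ P ∧ P \ O ∈ subpolyhedra P}

/-!
Polyhedra are handled through hyperplane arrangements instead of triangulations. A finite set `L` of
affine functionals cuts the space into finitely many relatively open cells, the fibres of the sign
vector `signVec L`. The unions of cells (`SignSaturated L`) form a finite Boolean algebra of sets, and
it is stable under closure: the closure of a cell is got by weakening its strict inequalities
(`SignSaturated.closure_eq`), so it is again a union of cells. Hence the unions of cells are closed
under `(S, T) ↦ closure (S \ T)`, which is the co-Heyting implication of closed sets and, on
complements, the Heyting implication of open sets.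

The polyhedra are exactly the compact sets that are saturated for some finite `L`. A simplex is
described by signs of barycentric coordinates (`AffineIndependent.exists_signSaturated_convexHull`),
and Carathéodory's theorem writes a polytope as a finite union of simplices. Conversely, a compact
closed cell has at most one extreme point in each open cell
(`SignSaturated.injOn_extremePoints`), so by Krein–Milman it is a polytope. Since any finite number of
polyhedra are saturated for a common finite `L`, polyhedra are stable under the operations, and
finitely many of them generate a subalgebra of the finite algebra of unions of cells, which is the
local finiteness.
-/

/-! ### Cells of a hyperplane arrangement -/

section SignCells

variable {E : Type*} [NormedAddCommGroup E] [NormedSpace ℝ E]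

/-- The vector of signs that the affine functionals in `L` take at `x`. Its fibres are the relatively
open cells of the arrangement of the hyperplanes `f = 0` with `f ∈ L`. -/
noncomputable def signVec (L : Set (E →ᵃ[ℝ] ℝ)) (x : E) : L → SignType :=
  fun f => SignType.sign (f.1 x)

/-- A set is saturated for `L` if it is a union of cells of the arrangement given by `L`. -/
def SignSaturated (L : Set (E →ᵃ[ℝ] ℝ)) (S : Set E) : Prop :=
  ∃ T : Set (L → SignType), S = signVec L ⁻¹' T

/-- The closed cell of the sign vector `σ`: the strict inequalities among the sign conditions are
weakened, the equations are kept. It is the closure of the cell of `σ` if that cell is nonempty, which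
is why it is mostly used for `σ = signVec L z`. -/
def closedCell {L : Set (E →ᵃ[ℝ] ℝ)} (σ : L → SignType) : Set E :=
  {x | ∀ f : L, (0 ≤ σ f → 0 ≤ f.1 x) ∧ (σ f ≤ 0 → f.1 x ≤ 0)}

theorem mem_closedCell_signVec {L : Set (E →ᵃ[ℝ] ℝ)} {x z : E} :
    x ∈ closedCell (signVec L z) ↔
      ∀ f ∈ L, (0 ≤ f z → 0 ≤ f x) ∧ (f z ≤ 0 → f x ≤ 0) := by
  simp [closedCell, signVec, sign_nonneg_iff, sign_nonpos_iff]

theorem self_mem_closedCell (L : Set (E →ᵃ[ℝ] ℝ)) (z : E) : z ∈ closedCell (signVec L z) :=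
  mem_closedCell_signVec.2 fun _ _ => ⟨id, id⟩

namespace SignSaturated

variable {L M : Set (E →ᵃ[ℝ] ℝ)} {S T : Set E}

theorem mem_of_signVec_eq (hS : SignSaturated L S) {x y : E} (h : signVec L x = signVec L y)
    (hx : x ∈ S) : y ∈ S := by
  obtain ⟨T, rfl⟩ := hS
  simpa [← h] using hx

theorem of_forall (h : ∀ x ∈ S, ∀ y, signVec L x = signVec L y → y ∈ S) : SignSaturated L S := by
  refine ⟨signVec L '' S, Set.Subset.antisymm (Set.subset_preimage_image _ _) ?_⟩
  rintro y ⟨x, hx, hxy⟩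
  exact h x hx y hxy

theorem mono (h : L ⊆ M) (hS : SignSaturated L S) : SignSaturated M S :=
  of_forall fun _ hx _ hxy => hS.mem_of_signVec_eq
    (funext fun f => congrFun hxy ⟨f.1, h f.2⟩) hx

theorem empty : SignSaturated L (∅ : Set E) := ⟨∅, rfl⟩

theorem union (hS : SignSaturated L S) (hT : SignSaturated L T) : SignSaturated L (S ∪ T) := by
  obtain ⟨A, rfl⟩ := hS
  obtain ⟨B, rfl⟩ := hT
  exact ⟨A ∪ B, rfl⟩

theorem inter (hS : SignSaturated L S) (hT : SignSaturated L T) : SignSaturated L (S ∩ T) := by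
  obtain ⟨A, rfl⟩ := hS
  obtain ⟨B, rfl⟩ := hT
  exact ⟨A ∩ B, rfl⟩

theorem diff (hS : SignSaturated L S) (hT : SignSaturated L T) : SignSaturated L (S \ T) := by
  obtain ⟨A, rfl⟩ := hS
  obtain ⟨B, rfl⟩ := hT
  exact ⟨A \ B, rfl⟩

theorem sUnion {F : Set (Set E)} (hF : ∀ S ∈ F, SignSaturated L S) : SignSaturated L (⋃₀ F) := by
  refine of_forall ?_
  rintro x ⟨S, hS, hx⟩ y hxy
  exact ⟨S, hS, (hF S hS).mem_of_signVec_eq hxy hx⟩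

theorem finite_setOf (hL : L.Finite) : {S : Set E | SignSaturated L S}.Finite := by
  have := hL.to_subtype
  refine (Set.finite_range fun T : Set (L → SignType) => signVec L ⁻¹' T).subset ?_
  rintro S ⟨T, rfl⟩
  exact ⟨T, rfl⟩

end SignSaturated

theorem signSaturated_closedCell {L : Set (E →ᵃ[ℝ] ℝ)} (σ : L → SignType) :
    SignSaturated L (closedCell σ) := by
  refine ⟨{τ | ∀ f, (0 ≤ σ f → 0 ≤ τ f) ∧ (σ f ≤ 0 → τ f ≤ 0)}, ?_⟩
  ext x
  simp [closedCell, signVec, sign_nonneg_iff, sign_nonpos_iff]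

theorem exists_signSaturated_of_finite {F : Set (Set E)} (hF : F.Finite)
    (h : ∀ S ∈ F, ∃ L : Set (E →ᵃ[ℝ] ℝ), L.Finite ∧ SignSaturated L S) :
    ∃ L : Set (E →ᵃ[ℝ] ℝ), L.Finite ∧ ∀ S ∈ F, SignSaturated L S := by
  choose! L hL hS using h
  exact ⟨⋃ S ∈ F, L S, hF.biUnion hL,
    fun S h => (hS S h).mono (Set.subset_biUnion_of_mem (u := L) h)⟩

theorem convex_closedCell {L : Set (E →ᵃ[ℝ] ℝ)} (σ : L → SignType) : Convex ℝ (closedCell σ) := by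
  intro x hx y hy a b ha hb hab f
  rw [Convex.combo_affine_apply hab]
  obtain ⟨hx₁, hx₂⟩ := hx f
  obtain ⟨hy₁, hy₂⟩ := hy f
  exact ⟨fun h => convex_Ici (0 : ℝ) (hx₁ h) (hy₁ h) ha hb hab,
    fun h => convex_Iic (0 : ℝ) (hx₂ h) (hy₂ h) ha hb hab⟩

theorem finite_setOf_closedCell {L : Set (E →ᵃ[ℝ] ℝ)} (hL : L.Finite) (S : Set E) :
    ((fun z => closedCell (signVec L z)) '' S).Finite := by
  have := hL.to_subtype
  exact (Set.finite_range (closedCell (L := L))).subset fun _ ⟨z, _, h⟩ => ⟨_, h⟩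

/-- Moving from a point of a closed cell towards a point of the open cell enters the open cell at
once. -/
theorem signVec_eq_of_mem_openSegment {L : Set (E →ᵃ[ℝ] ℝ)} {x z w : E}
    (hx : x ∈ closedCell (signVec L z)) (hw : w ∈ openSegment ℝ x z) :
    signVec L w = signVec L z := by
  obtain ⟨a, b, ha, hb, hab, rfl⟩ := hw
  funext ⟨f, hf⟩
  obtain ⟨h₁, h₂⟩ := mem_closedCell_signVec.1 hx f hf
  simp only [signVec]
  rw [Convex.combo_affine_apply hab]
  simp only [smul_eq_mul]
  rcases lt_trichotomy (f z) 0 with h | h | h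
  · have := h₂ h.le
    rw [sign_neg h, sign_neg]
    nlinarith
  · have : f x = 0 := le_antisymm (h₂ h.le) (h₁ h.ge)
    simp [this, h]
  · have := h₁ h.le
    rw [sign_pos h, sign_pos]
    nlinarith

variable [FiniteDimensional ℝ E]

theorem isClosed_closedCell {L : Set (E →ᵃ[ℝ] ℝ)} (σ : L → SignType) :
    IsClosed (closedCell σ) := by
  simp only [closedCell, Set.ofPred_forall, Set.ofPred_and]
  refine isClosed_iInter fun f => ?_
  have hf := f.1.continuous_of_finiteDimensional
  exact (isClosed_iInter fun _ => isClosed_le continuous_const hf).inter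
    (isClosed_iInter fun _ => isClosed_le hf continuous_const)

/-- The closure of a union of cells is the union of the corresponding closed cells. -/
theorem SignSaturated.closure_eq {L : Set (E →ᵃ[ℝ] ℝ)} (hL : L.Finite) {S : Set E}
    (hS : SignSaturated L S) :
    closure S = ⋃₀ ((fun z => closedCell (signVec L z)) '' S) := by
  refine Set.Subset.antisymm (closure_minimal ?_ ?_) ?_
  · exact fun z hz => ⟨_, ⟨z, hz, rfl⟩, self_mem_closedCell L z⟩
  · rw [Set.sUnion_eq_biUnion]
    refine (finite_setOf_closedCell hL S).isClosed_biUnion ?_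
    rintro _ ⟨z, _, rfl⟩
    exact isClosed_closedCell _
  · rintro x ⟨_, ⟨z, hz, rfl⟩, hx⟩
    have h : openSegment ℝ x z ⊆ S := fun w hw =>
      hS.mem_of_signVec_eq (signVec_eq_of_mem_openSegment hx hw).symm hz
    exact closure_mono h (segment_subset_closure_openSegment (left_mem_segment ℝ x z))

theorem SignSaturated.closure {L : Set (E →ᵃ[ℝ] ℝ)} (hL : L.Finite) {S : Set E}
    (hS : SignSaturated L S) : SignSaturated L (closure S) := by
  rw [hS.closure_eq hL]
  refine SignSaturated.sUnion ?_
  rintro _ ⟨z, _, rfl⟩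
  exact signSaturated_closedCell _

/-- A union of cells of a finite arrangement has at most one extreme point in each cell: if `y` has
the same signs as `x`, the segment from `y` to `x` can be prolonged a little beyond `x` within the
cell. -/
theorem SignSaturated.injOn_extremePoints {L : Set (E →ᵃ[ℝ] ℝ)} (hL : L.Finite) {S : Set E}
    (hS : SignSaturated L S) : Set.InjOn (signVec L) (S.extremePoints ℝ) := by
  intro x hx y hy hxy
  have := hL.to_subtype
  have key : ∀ᶠ ε : ℝ in nhdsWithin 0 (Set.Ioi 0),
      ∀ f : L, SignType.sign (f.1 (AffineMap.lineMap x y (-ε))) = SignType.sign (f.1 x) := by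
    rw [Filter.eventually_all]
    intro f
    have hcont : Continuous fun ε : ℝ => f.1 (AffineMap.lineMap x y (-ε)) :=
      f.1.continuous_of_finiteDimensional.comp
        (AffineMap.lineMap_continuous.comp continuous_neg)
    have hf : SignType.sign (f.1 x) = SignType.sign (f.1 y) := congrFun hxy f
    refine nhdsWithin_le_nhds ?_
    rcases lt_trichotomy (f.1 x) 0 with h | h | h
    · filter_upwards [hcont.continuousAt.tendsto.eventually_lt_const (u := 0) (by simpa using h)]
        with ε hε
      rw [sign_neg h, sign_neg hε]
    · have hy0 : f.1 y = 0 := by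
        rw [h, sign_zero] at hf
        exact sign_eq_zero_iff.1 hf.symm
      refine Filter.Eventually.of_forall fun ε => ?_
      rw [AffineMap.apply_lineMap, h, hy0]
      simp
    · filter_upwards [hcont.continuousAt.tendsto.eventually_const_lt (u := 0) (by simpa using h)]
        with ε hε
      rw [sign_pos h, sign_pos hε]
  obtain ⟨ε, hε, hε0⟩ := (key.and self_mem_nhdsWithin).exists
  replace hε0 : 0 < ε := hε0
  rw [mem_extremePoints] at hx
  refine ((hx.2 _ (hS.mem_of_signVec_eq (funext hε).symm hx.1) y hy.1 ?_).2).symm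
  -- For `z = x - ε (y - x)` one has `x = (z + ε y) / (1 + ε)`.
  refine ⟨1 / (1 + ε), ε / (1 + ε), by positivity, by positivity, by field_simp, ?_⟩
  rw [AffineMap.lineMap_apply_module]
  match_scalars <;> field_simp <;> ring

/-- By the Krein–Milman theorem, a compact convex union of cells is the closed convex hull of its
extreme points, of which there are only finitely many. -/
theorem IsCompact.exists_finite_convexHull_eq {L : Set (E →ᵃ[ℝ] ℝ)} (hL : L.Finite) {S : Set E}
    (hS : SignSaturated L S) (hc : IsCompact S) (hconv : Convex ℝ S) :
    ∃ V : Set E, V.Finite ∧ S = convexHull ℝ V := by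
  have := hL.to_subtype
  have hfin : (S.extremePoints ℝ).Finite :=
    Set.Finite.of_finite_image (Set.toFinite _) (hS.injOn_extremePoints hL)
  refine ⟨_, hfin, ?_⟩
  conv_lhs => rw [← closure_convexHull_extremePoints hc hconv]
  exact (hfin.isClosed_convexHull ℝ).closure_eq

/-- A simplex is described by sign conditions on barycentric coordinates, once its vertices are
completed to an affine basis of the whole space. -/
theorem AffineIndependent.exists_signSaturated_convexHull {s : Set E}
    (hs : AffineIndependent ℝ ((↑) : s → E)) :
    ∃ L : Set (E →ᵃ[ℝ] ℝ), L.Finite ∧ SignSaturated L (convexHull ℝ s) := by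
  obtain ⟨t, hst, hti, htop⟩ := exists_subset_affineIndependent_affineSpan_eq_top hs
  let b : AffineBasis t ℝ E := ⟨(↑), hti, by rwa [Subtype.range_coe]⟩
  have hb : ∀ i : t, b i = i := fun _ => rfl
  have : Finite t := finite_of_fin_dim_affineIndependent ℝ hti
  have := Fintype.ofFinite t
  classical
  have heq : convexHull ℝ s =
      {x | ∀ i : t, 0 ≤ b.coord i x ∧ (i.1 ∉ s → b.coord i x ≤ 0)} := by
    refine Set.Subset.antisymm (convexHull_min ?_ ?_) ?_
    · intro x hx i
      have hx' : x = b ⟨x, hst hx⟩ := rfl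
      rw [hx', b.coord_apply]
      split_ifs with h
      · exact ⟨zero_le_one, fun hi => absurd (h ▸ hx) hi⟩
      · exact ⟨le_rfl, fun _ => le_rfl⟩
    · intro x hx y hy a c ha hc hac i
      rw [Convex.combo_affine_apply hac]
      exact ⟨convex_Ici (0 : ℝ) (hx i).1 (hy i).1 ha hc hac,
        fun h => convex_Iic (0 : ℝ) ((hx i).2 h) ((hy i).2 h) ha hc hac⟩
    · intro x hx
      have h0 : ∀ i : t, i.1 ∉ s → b.coord i x = 0 := fun i hi => le_antisymm ((hx i).2 hi) (hx i).1
      have hsum : ∑ i ∈ Finset.univ.filter (fun i : t => i.1 ∈ s), b.coord i x • b i = x := by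
        rw [Finset.sum_filter_of_ne, b.linear_combination_coord_eq_self]
        intro i _ hi
        by_contra his
        exact hi (by rw [h0 i his, zero_smul])
      rw [← hsum]
      refine (convex_convexHull ℝ s).sum_mem (fun i _ => (hx i).1) ?_ ?_
      · rw [Finset.sum_filter_of_ne, b.sum_coord_apply_eq_one]
        intro i _ hi
        by_contra his
        exact hi (h0 i his)
      · intro i hi
        exact subset_convexHull ℝ s (Finset.mem_filter.1 hi).2
  refine ⟨Set.range b.coord, Set.finite_range _, .of_forall fun x hx y hxy => ?_⟩
  rw [heq] at hx ⊢
  intro i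
  have hi : SignType.sign (b.coord i x) = SignType.sign (b.coord i y) :=
    congrFun hxy ⟨b.coord i, i, rfl⟩
  rw [← sign_nonneg_iff, ← sign_nonpos_iff, ← hi, sign_nonneg_iff, sign_nonpos_iff]
  exact hx i

/-- By Carathéodory's theorem, a polytope is a finite union of simplices, which are saturated for a
common arrangement. -/
theorem Set.Finite.exists_signSaturated_convexHull {V : Set E} (hV : V.Finite) :
    ∃ L : Set (E →ᵃ[ℝ] ℝ), L.Finite ∧ SignSaturated L (convexHull ℝ V) := by
  let F : Set (Set E) :=
    (fun s => convexHull ℝ s) '' {s | s ⊆ V ∧ AffineIndependent ℝ ((↑) : s → E)}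
  have hF : F.Finite := (hV.finite_subsets.subset fun s hs => hs.1).image _
  obtain ⟨L, hL, h⟩ := exists_signSaturated_of_finite hF (by
    rintro _ ⟨s, hs, rfl⟩
    exact hs.2.exists_signSaturated_convexHull)
  refine ⟨L, hL, ?_⟩
  have heq : convexHull ℝ V = ⋃₀ F := by
    refine Set.Subset.antisymm ?_ ?_
    · rw [convexHull_eq_union]
      intro x hx
      simp only [Set.mem_iUnion] at hx
      obtain ⟨t, ht, hti, hx⟩ := hx
      exact ⟨_, ⟨t, ⟨ht, hti⟩, rfl⟩, hx⟩
    · rintro x ⟨_, ⟨s, hs, rfl⟩, hx⟩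
      exact convexHull_mono hs.1 hx
  rw [heq]
  exact .sUnion h

end SignCells

/-! ### Polyhedra as unions of cells -/

section Polyhedra

variable {n : ℕ} {P Q : Set (EuclideanSpace ℝ (Fin n))}

theorem IsPolyhedron.isCompact (hP : IsPolyhedron P) : IsCompact P := by
  obtain ⟨F, hF, h, rfl⟩ := hP
  refine hF.isCompact_sUnion fun T hT => ?_
  obtain ⟨V, hV, rfl⟩ := h T hT
  exact hV.isCompact_convexHull ℝ

theorem IsPolyhedron.exists_signSaturated (hP : IsPolyhedron P) :
    ∃ L : Set (EuclideanSpace ℝ (Fin n) →ᵃ[ℝ] ℝ), L.Finite ∧ SignSaturated L P := by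
  obtain ⟨F, hF, h, rfl⟩ := hP
  obtain ⟨L, hL, hS⟩ := exists_signSaturated_of_finite hF fun T hT => by
    obtain ⟨V, hV, rfl⟩ := h T hT
    exact hV.exists_signSaturated_convexHull
  exact ⟨L, hL, .sUnion hS⟩

/-- A compact union of cells is closed, hence the finite union of the closed cells it contains, each
of which is a polytope. -/
theorem SignSaturated.isPolyhedron {L : Set (EuclideanSpace ℝ (Fin n) →ᵃ[ℝ] ℝ)} (hL : L.Finite)
    (hP : SignSaturated L P) (hc : IsCompact P) : IsPolyhedron P := by
  have heq := hP.closure_eq hL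
  rw [hc.isClosed.closure_eq] at heq
  refine ⟨_, finite_setOf_closedCell hL P, ?_, heq⟩
  rintro T hT
  have hTP : T ⊆ P := heq ▸ Set.subset_sUnion_of_mem hT
  obtain ⟨z, -, rfl⟩ := hT
  exact IsCompact.exists_finite_convexHull_eq hL (signSaturated_closedCell _)
    (hc.of_isClosed_subset (isClosed_closedCell _) hTP) (convex_closedCell _)

theorem exists_signSaturated_of_isPolyhedron {F : Set (Set (EuclideanSpace ℝ (Fin n)))}
    (hF : F.Finite) (h : ∀ S ∈ F, IsPolyhedron S) :
    ∃ L : Set (EuclideanSpace ℝ (Fin n) →ᵃ[ℝ] ℝ), L.Finite ∧ ∀ S ∈ F, SignSaturated L S :=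
  exists_signSaturated_of_finite hF fun S hS => (h S hS).exists_signSaturated

theorem isPolyhedron_empty : IsPolyhedron (∅ : Set (EuclideanSpace ℝ (Fin n))) :=
  ⟨∅, Set.finite_empty, by simp, by simp⟩

theorem IsPolyhedron.exists_signSaturated_pair (hP : IsPolyhedron P) (hQ : IsPolyhedron Q) :
    ∃ L : Set (EuclideanSpace ℝ (Fin n) →ᵃ[ℝ] ℝ), L.Finite ∧ SignSaturated L P ∧
      SignSaturated L Q := by
  obtain ⟨L, hL, hS⟩ := hP.exists_signSaturated
  obtain ⟨M, hM, hT⟩ := hQ.exists_signSaturated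
  exact ⟨L ∪ M, hL.union hM, hS.mono Set.subset_union_left, hT.mono Set.subset_union_right⟩

theorem IsPolyhedron.union (hP : IsPolyhedron P) (hQ : IsPolyhedron Q) : IsPolyhedron (P ∪ Q) := by
  obtain ⟨L, hL, hS, hT⟩ := hP.exists_signSaturated_pair hQ
  exact (hS.union hT).isPolyhedron hL (hP.isCompact.union hQ.isCompact)

theorem IsPolyhedron.inter (hP : IsPolyhedron P) (hQ : IsPolyhedron Q) : IsPolyhedron (P ∩ Q) := by
  obtain ⟨L, hL, hS, hT⟩ := hP.exists_signSaturated_pair hQ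
  exact (hS.inter hT).isPolyhedron hL (hP.isCompact.inter hQ.isCompact)

theorem IsPolyhedron.closure_diff (hP : IsPolyhedron P) (hQ : IsPolyhedron Q) :
    IsPolyhedron (closure (P \ Q)) := by
  obtain ⟨L, hL, hS, hT⟩ := hP.exists_signSaturated_pair hQ
  exact ((hS.diff hT).closure hL).isPolyhedron hL
    (hP.isCompact.closure_of_subset Set.sdiff_subset)

end Polyhedra

/-! ### The implications in the algebras of open and closed sets -/

section OpensCloseds

variable {X : Type*} [TopologicalSpace X]

theorem TopologicalSpace.Closeds.coe_sdiff (C D : Closeds X) :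
    ((C \ D : Closeds X) : Set X) = closure ((C : Set X) \ D) := by
  refine Set.Subset.antisymm ?_ (closure_minimal ?_ (C \ D).isClosed)
  · have h : C \ D ≤ Closeds.closure ((C : Set X) \ D) := by
      rw [sdiff_le_iff]
      intro x hx
      by_cases hD : x ∈ (D : Set X)
      · exact Or.inl hD
      · exact Or.inr (subset_closure ⟨hx, hD⟩)
    exact h
  · rintro x ⟨hC, hD⟩
    exact ((le_sup_sdiff : C ≤ D ⊔ C \ D) hC).resolve_left hD

/-- In terms of complements, the implication of open sets is the co-Heyting implication of closed
sets, so that one computation of `closure (S \ T)` serves both algebras. -/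
theorem TopologicalSpace.Opens.compl_coe_himp (U V : Opens X) :
    (((U ⇨ V : Opens X) : Set X))ᶜ = closure ((V : Set X)ᶜ \ (U : Set X)ᶜ) := by
  refine Set.Subset.antisymm ?_ (closure_minimal ?_ (U ⇨ V).isOpen.isClosed_compl)
  · have h : (Closeds.closure ((V : Set X)ᶜ \ (U : Set X)ᶜ)).compl ≤ U ⇨ V := by
      rw [le_himp_iff]
      rintro x ⟨hx, hU⟩
      by_contra hV
      exact hx (subset_closure ⟨hV, fun h => h hU⟩)
    exact Set.compl_subset_comm.1 h
  · rintro x ⟨hV, hU⟩ hx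
    exact hV ((himp_inf_le : (U ⇨ V) ⊓ U ≤ V) ⟨hx, not_not.1 hU⟩)

end OpensCloseds

/-! ### Locally finite algebras attached to classes of sets -/

theorem isLocallyFiniteHeyting_of_finite {H : Type*} [HeytingAlgebra H]
    (h : ∀ S : Set H, S.Finite → ∃ B : HeytingSubalgebra H, S ⊆ B.carrier ∧ B.carrier.Finite) :
    IsLocallyFiniteHeyting H := by
  rintro _ ⟨S, hS, rfl⟩
  obtain ⟨B, hSB, hB⟩ := h S hS
  exact hB.subset fun a ha => ha B hSB

theorem isLocallyFiniteCoheyting_of_finite {H : Type*} [CoheytingAlgebra H]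
    (h : ∀ S : Set H, S.Finite → ∃ B : CoheytingSubalgebra H, S ⊆ B.carrier ∧ B.carrier.Finite) :
    IsLocallyFiniteCoheyting H := by
  rintro _ ⟨S, hS, rfl⟩
  obtain ⟨B, hSB, hB⟩ := h S hS
  exact hB.subset fun a ha => ha B hSB

section Subalgebras

variable {E : Type*} [TopologicalSpace E] {P : Set E} {p : Set E → Prop}

/-- A class of subsets of the ambient space that contains `∅` and `P` and is stable under `∪`, `∩`
and `closure (S \ T)`. For closed `P`, its members inside `P` are then stable under the co-Heyting
operations of the closed subsets of `P`. The members are required neither to be closed nor to lie in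
`P`, so that all sets saturated for some `L` form such a class. -/
structure IsCoheytingClass (P : Set E) (p : Set E → Prop) : Prop where
  empty : p ∅
  self : p P
  union : ∀ {S T}, p S → p T → p (S ∪ T)
  inter : ∀ {S T}, p S → p T → p (S ∩ T)
  closure_diff : ∀ {S T}, p S → p T → p (closure (S \ T))

theorem image_val_closure (hP : IsClosed P) (S : Set P) :
    Subtype.val '' closure S = closure (Subtype.val '' S) :=
  (hP.isClosedEmbedding_subtypeVal.closure_image_eq S).symm

theorem IsCoheytingClass.image_val_closure_diff (hp : IsCoheytingClass P p) (hP : IsClosed P)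
    {S T : Set P} (hS : p (Subtype.val '' S)) (hT : p (Subtype.val '' T)) :
    p (Subtype.val '' closure (S \ T)) := by
  rw [image_val_closure hP, Set.image_sdiff Subtype.val_injective]
  exact hp.closure_diff hS hT

/-- The closed subsets of `P` whose image in the ambient space belongs to the class `p`. -/
def IsCoheytingClass.closedsSubalgebra (hp : IsCoheytingClass P p) (hP : IsClosed P) :
    CoheytingSubalgebra (Closeds P) where
  carrier := {C | p (Subtype.val '' (C : Set P))}
  bot_mem' := by simpa using hp.empty
  top_mem' := by simpa using hp.self
  sup_mem' {C D} hC hD := by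
    simpa [Set.image_union] using hp.union hC hD
  inf_mem' {C D} hC hD := by
    simpa [Set.image_inter Subtype.val_injective] using hp.inter hC hD
  sdiff_mem' {C D} hC hD := by
    rw [Set.mem_ofPred_eq, Closeds.coe_sdiff]
    exact hp.image_val_closure_diff hP hC hD

/-- The open subsets of `P` whose complement in `P` belongs to the class `p`. -/
def IsCoheytingClass.opensSubalgebra (hp : IsCoheytingClass P p) (hP : IsClosed P) :
    HeytingSubalgebra (Opens P) where
  carrier := {U | p (Subtype.val '' (U : Set P)ᶜ)}
  bot_mem' := by simpa using hp.self
  top_mem' := by simpa using hp.empty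
  sup_mem' {U V} hU hV := by
    rw [Set.mem_ofPred_eq, Opens.coe_sup, Set.compl_union, Set.image_inter Subtype.val_injective]
    exact hp.inter hU hV
  inf_mem' {U V} hU hV := by
    rw [Set.mem_ofPred_eq, Opens.coe_inf, Set.compl_inter, Set.image_union]
    exact hp.union hU hV
  himp_mem' {U V} hU hV := by
    rw [Set.mem_ofPred_eq, Opens.compl_coe_himp]
    exact hp.image_val_closure_diff hP hV hU

/-- Finitely many members of `closedsSubalgebra` generate a subalgebra of the one attached to any
class `q` that contains their images; it is finite as soon as `q` is. -/
theorem IsCoheytingClass.isLocallyFiniteCoheyting (hp : IsCoheytingClass P p) (hP : IsClosed P)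
    (h : ∀ F : Set (Set E), F.Finite → (∀ S ∈ F, p S) →
      ∃ q, IsCoheytingClass P q ∧ (∀ S ∈ F, q S) ∧ {S | q S}.Finite) :
    IsLocallyFiniteCoheyting (hp.closedsSubalgebra hP) := by
  refine isLocallyFiniteCoheyting_of_finite fun S hS => ?_
  let e : hp.closedsSubalgebra hP → Set E := fun C => Subtype.val '' (C.1 : Set P)
  have he : Function.Injective e := fun C D hCD =>
    Subtype.ext (Closeds.ext (Set.image_injective.2 Subtype.val_injective hCD))
  obtain ⟨q, hq, hSq, hfin⟩ := h (e '' S) (hS.image e) (by rintro _ ⟨C, -, rfl⟩; exact C.2)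
  let B := hq.closedsSubalgebra hP
  refine ⟨⟨{C | C.1 ∈ B.carrier}, B.bot_mem', B.top_mem', fun h₁ h₂ => B.sup_mem' h₁ h₂,
    fun h₁ h₂ => B.inf_mem' h₁ h₂, fun h₁ h₂ => B.sdiff_mem' h₁ h₂⟩,
    fun C hC => hSq _ ⟨C, hC, rfl⟩, ?_⟩
  exact (hfin.preimage he.injOn : (e ⁻¹' {S | q S}).Finite)

theorem IsCoheytingClass.isLocallyFiniteHeyting (hp : IsCoheytingClass P p) (hP : IsClosed P)
    (h : ∀ F : Set (Set E), F.Finite → (∀ S ∈ F, p S) →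
      ∃ q, IsCoheytingClass P q ∧ (∀ S ∈ F, q S) ∧ {S | q S}.Finite) :
    IsLocallyFiniteHeyting (hp.opensSubalgebra hP) := by
  refine isLocallyFiniteHeyting_of_finite fun S hS => ?_
  let e : hp.opensSubalgebra hP → Set E := fun U => Subtype.val '' (U.1 : Set P)ᶜ
  have he : Function.Injective e := fun U V hUV =>
    Subtype.ext (Opens.ext (compl_injective (Set.image_injective.2 Subtype.val_injective hUV)))
  obtain ⟨q, hq, hSq, hfin⟩ := h (e '' S) (hS.image e) (by rintro _ ⟨U, -, rfl⟩; exact U.2)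
  let B := hq.opensSubalgebra hP
  refine ⟨⟨{U | U.1 ∈ B.carrier}, B.bot_mem', B.top_mem', fun h₁ h₂ => B.sup_mem' h₁ h₂,
    fun h₁ h₂ => B.inf_mem' h₁ h₂, fun h₁ h₂ => B.himp_mem' h₁ h₂⟩,
    fun U hU => hSq _ ⟨U, hU, rfl⟩, ?_⟩
  exact (hfin.preimage he.injOn : (e ⁻¹' {S | q S}).Finite)

end Subalgebras

/-! ### The subpolyhedra of a polyhedron -/

section PolyhedralClasses

variable {n : ℕ} {P : Set (EuclideanSpace ℝ (Fin n))}

theorem IsPolyhedron.isCoheytingClass (hP : IsPolyhedron P) : IsCoheytingClass P IsPolyhedron where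
  empty := isPolyhedron_empty
  self := hP
  union := .union
  inter := .inter
  closure_diff := .closure_diff

theorem SignSaturated.isCoheytingClass {L : Set (EuclideanSpace ℝ (Fin n) →ᵃ[ℝ] ℝ)}
    (hL : L.Finite) (hP : SignSaturated L P) : IsCoheytingClass P (SignSaturated L) where
  empty := .empty
  self := hP
  union := .union
  inter := .inter
  closure_diff hS hT := (hS.diff hT).closure hL

/-- Finitely many polyhedra lie in a finite class: the unions of cells of an arrangement for which
they and `P` are all saturated. -/
theorem IsPolyhedron.exists_finite_isCoheytingClass (hP : IsPolyhedron P)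
    (F : Set (Set (EuclideanSpace ℝ (Fin n)))) (hF : F.Finite) (h : ∀ S ∈ F, IsPolyhedron S) :
    ∃ q, IsCoheytingClass P q ∧ (∀ S ∈ F, q S) ∧ {S | q S}.Finite := by
  obtain ⟨L, hL, hS⟩ := exists_signSaturated_of_isPolyhedron (hF.insert P)
    (Set.forall_mem_insert.2 ⟨hP, h⟩)
  rw [Set.forall_mem_insert] at hS
  exact ⟨SignSaturated L, hS.1.isCoheytingClass hL, hS.2, SignSaturated.finite_setOf hL⟩

theorem image_closedsSubalgebra_isPolyhedron (hP : IsPolyhedron P) :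
    (fun C : Closeds P => (Subtype.val '' (C : Set P) : Set (EuclideanSpace ℝ (Fin n)))) ''
      (hP.isCoheytingClass.closedsSubalgebra hP.isCompact.isClosed : Set (Closeds P)) =
      subpolyhedra P := by
  refine Set.Subset.antisymm ?_ ?_
  · rintro _ ⟨C, hC, rfl⟩
    exact ⟨Subtype.coe_image_subset _ _, hC⟩
  · rintro Q ⟨hQP, hQ⟩
    have h : Subtype.val '' ((Subtype.val : P → _) ⁻¹' Q) = Q :=
      Subtype.image_preimage_coe P Q ▸ Set.inter_eq_self_of_subset_right hQP
    refine ⟨⟨Subtype.val ⁻¹' Q, hQ.isCompact.isClosed.preimage continuous_subtype_val⟩, ?_, h⟩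
    exact (congrArg IsPolyhedron h).mpr hQ

theorem image_opensSubalgebra_isPolyhedron (hP : IsPolyhedron P) :
    (fun U : Opens P => (Subtype.val '' (U : Set P) : Set (EuclideanSpace ℝ (Fin n)))) ''
      (hP.isCoheytingClass.opensSubalgebra hP.isCompact.isClosed : Set (Opens P)) =
      openSubpolyhedra P := by
  have hcompl : ∀ U : Set P, P \ Subtype.val '' U = Subtype.val '' Uᶜ := fun U => by
    rw [Set.image_compl_eq_range_sdiff_image Subtype.val_injective, Subtype.range_coe]
  refine Set.Subset.antisymm ?_ ?_
  · rintro _ ⟨U, hU, rfl⟩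
    refine ⟨Subtype.coe_image_subset _ _, Set.sdiff_subset, ?_⟩
    rw [hcompl]
    exact hU
  · rintro O ⟨hOP, -, hO⟩
    have h : Subtype.val '' ((Subtype.val : P → _) ⁻¹' O) = O :=
      Subtype.image_preimage_coe P O ▸ Set.inter_eq_self_of_subset_right hOP
    have h' : Subtype.val '' ((Subtype.val : P → _) ⁻¹' O)ᶜ = P \ O := by rw [← hcompl, h]
    refine ⟨⟨Subtype.val ⁻¹' O, ?_⟩, ?_, h⟩
    · rw [← isClosed_compl_iff]
      convert hO.isCompact.isClosed.preimage (continuous_subtype_val (p := (· ∈ P))) using 1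
      ext x
      simp
    · exact (congrArg IsPolyhedron h').mpr hO

end PolyhedralClasses

/-- For a polyhedron `P` in `ℝⁿ` with the subspace topology, the open subpolyhedra of `P` form a
Heyting subalgebra of the Heyting algebra of open sets of `P`, and this Heyting algebra is locally
finite; the subpolyhedra of `P` form a co-Heyting subalgebra of the co-Heyting algebra of closed
sets of `P`, and this co-Heyting algebra is locally finite. -/
theorem corollary3p7 (n : ℕ) (P : Set (EuclideanSpace ℝ (Fin n))) (hP : IsPolyhedron P) :
    (∃ A : HeytingSubalgebra (Opens P),
      (fun U : Opens P => (Subtype.val '' (U : Set P) : Set (EuclideanSpace ℝ (Fin n)))) ''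
        (A : Set (Opens P)) = openSubpolyhedra P ∧
      IsLocallyFiniteHeyting A) ∧
    (∃ B : CoheytingSubalgebra (Closeds P),
      (fun C : Closeds P => (Subtype.val '' (C : Set P) : Set (EuclideanSpace ℝ (Fin n)))) ''
        (B : Set (Closeds P)) = subpolyhedra P ∧
      IsLocallyFiniteCoheyting B) :=
  ⟨⟨_, image_opensSubalgebra_isPolyhedron hP,
      hP.isCoheytingClass.isLocallyFiniteHeyting _ hP.exists_finite_isCoheytingClass⟩,
    ⟨_, image_closedsSubalgebra_isPolyhedron hP,
      hP.isCoheytingClass.isLocallyFiniteCoheyting _ hP.exists_finite_isCoheytingClass⟩⟩
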